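/- Let $1\le m\le n-1$ be integers and let $\mu$ be a Radon measure on $\mathbb{R}^n$, i.e. a Borel regular outer measure that is finite on compact sets. An $m$-dimensional Lipschitz graph is a set $\Gamma=\{v+f(v):v\in V\}$, where $V\subseteq\mathbb{R}^n$ is an $m$-dimensional linear subspace and $f:V\to V^\perp$ is Lipschitz. For an $m$-dimensional linear subspace $V$ and $\alpha\in(0,\infty)$, the bad cone is $$X=X(V,\alpha)=\{x\in\mathbb{R}^n:\operatorname{dist}(x,V)>\alpha\operatorname{dist}(x,V^\perp)\},$$ and $X_Q=\bigcup_{x\in Q}(x+X)$ for $Q\subseteq\mathbb{R}^n$. A dyadic cube is a set $Q=\prod_{i=1}^n[j_i2^{-k},(j_i+1)2^{-k})$ with $k,j_1,\dots,j_n\in\mathbb{Z}$; let $\operatorname{side}Q=2^{-k}$ and let $x_Q$ be its center. Put $r_{Q,X}=81\sqrt n\,\max(\alpha,1/\alpha)\operatorname{side}Q$ and, with $B$ and $U$ denoting closed and open balls, $$A_{Q,X}=X_Q\cap B(x_Q,r_{Q,X})\setminus U(x_Q,r_{Q,X}/3).$$ Let $\Delta^*_{Q,X}$ be the set of dyadic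 cubes $R$ with $\operatorname{side}R=\operatorname{side}Q$ and $R\cap A_{Q,X}\ne\emptyset$. Define $$\mathsf{Defect}(\mu,Q,X)=\sum_{R\in\Delta^*_{Q,X}}\frac{\mu(R)}{\mu(Q)}\ \text{ if }\mu(Q)>0,\qquad \mathsf{Defect}(\mu,Q,X)=0\ \text{ if }\mu(Q)=0,$$ and the conical Dini function $$G_{\mu,X}(x)=\sum_{\operatorname{side}Q\le1}\mathsf{Defect}(\mu,Q,X)\,\chi_Q(x)\in[0,\infty],\qquad x\in\mathbb{R}^n,$$ where the sum is over all dyadic cubes $Q$ of side length at most $1$. Then there is an $m$-dimensional Lipschitz graph $\Gamma$ with $\mu(\Gamma)>0$ if and only if there is a set $E\subseteq\mathbb{R}^n$ with $\mu(E)>0$ such that for every $x\in E$ there are an $m$-dimensional linear subspace $V_x\subseteq\mathbb{R}^n$ and $\alpha_x\in(0,\infty)$ with $G_{\mu,X(V_x,\alpha_x)}(x)<\infty$. -/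

import Mathlib

open MeasureTheory Set
open scoped ENNReal NNReal

noncomputable section

namespace RadonGraphs

/-- The `n`-dimensional Euclidean space. -/
abbrev Euc (n : ℕ) : Type := EuclideanSpace ℝ (Fin n)

/-! ### Lipschitz graphs and bad cones -/

/-- The graph `{(v, f v) : v ∈ V} ⊆ V × Vᗮ = ℝⁿ` of a function `f : V → Vᗮ`. -/
def graph {n : ℕ} (V : Submodule ℝ (Euc n)) (f : V → Vᗮ) : Set (Euc n) :=
  Set.range fun v : V => (v : Euc n) + (f v : Euc n)

/-- `Γ` is an `m`-dimensional Lipschitz graph in `ℝⁿ`: the graph of a Lipschitz function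
`f : V → Vᗮ` over some `m`-dimensional linear subspace `V`. -/
def IsLipschitzGraph {n : ℕ} (m : ℕ) (Γ : Set (Euc n)) : Prop :=
  ∃ V : Submodule ℝ (Euc n), Module.finrank ℝ V = m ∧
    ∃ f : V → Vᗮ, (∃ L : ℝ≥0, LipschitzWith L f) ∧ Γ = graph V f

/-- The bad cone `X(V, α) = {x : dist(x, V) > α dist(x, Vᗮ)}`. -/
def badCone {n : ℕ} (V : Submodule ℝ (Euc n)) (α : ℝ) : Set (Euc n) :=
  {x | Metric.infDist x (V : Set (Euc n)) > α * Metric.infDist x (Vᗮ : Set (Euc n))}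

/-- The union `X_S = ⋃ x ∈ S, (x + X(V, α))` of the bad cones centered at the points of `S`. -/
def badConeOn {n : ℕ} (V : Submodule ℝ (Euc n)) (α : ℝ) (S : Set (Euc n)) : Set (Euc n) :=
  ⋃ x ∈ S, (fun y => x + y) '' badCone V α

/-! ### Dyadic cubes -/

/-- A dyadic cube of `ℝⁿ`, given by its generation `k` and its corner `(j₁, …, jₙ)`. For `n ≥ 1`
different data give different subsets of `ℝⁿ`. -/
structure DyadicCube (n : ℕ) where
  gen : ℤ
  corner : Fin n → ℤ

namespace DyadicCube

variable {n : ℕ}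

/-- The side length `2⁻ᵏ`. -/
def side (Q : DyadicCube n) : ℝ := (2 : ℝ) ^ (-Q.gen)

/-- The half-open cube `∏ᵢ [jᵢ / 2ᵏ, (jᵢ + 1) / 2ᵏ)`. -/
def toSet (Q : DyadicCube n) : Set (Euc n) :=
  {x | ∀ i, x i ∈ Set.Ico ((Q.corner i : ℝ) / (2 : ℝ) ^ Q.gen)
    (((Q.corner i : ℝ) + 1) / (2 : ℝ) ^ Q.gen)}

/-- The geometric center of the cube. -/
def center (Q : DyadicCube n) : Euc n :=
  WithLp.toLp 2 fun i => ((Q.corner i : ℝ) + 1 / 2) / (2 : ℝ) ^ Q.gen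

end DyadicCube

/-! ### Conical defect and conical Dini function -/

/-- The radius `r_{Q,X} = 81 √n max(α, 1/α) side Q`. -/
def coneRadius {n : ℕ} (Q : DyadicCube n) (α : ℝ) : ℝ :=
  81 * Real.sqrt n * max α (1 / α) * Q.side

/-- The conical annulus `A_{Q,X} = X_Q ∩ B(x_Q, r_{Q,X}) \ U(x_Q, r_{Q,X} / 3)`, with `B` closed
and `U` open balls. -/
def conicalAnnulus {n : ℕ} (Q : DyadicCube n) (V : Submodule ℝ (Euc n)) (α : ℝ) :
    Set (Euc n) :=
  (badConeOn V α Q.toSet ∩ Metric.closedBall Q.center (coneRadius Q α)) \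
    Metric.ball Q.center (coneRadius Q α / 3)

/-- The discretized conical annulus `Δ*_{Q,X}`: the dyadic cubes of the side length of `Q` that
meet `A_{Q,X}`. -/
def discreteAnnulus {n : ℕ} (Q : DyadicCube n) (V : Submodule ℝ (Euc n)) (α : ℝ) :
    Set (DyadicCube n) :=
  {R | R.side = Q.side ∧ (R.toSet ∩ conicalAnnulus Q V α).Nonempty}

open Classical in
/-- The conical defect `∑_{R ∈ Δ*_{Q,X}} μ(R) / μ(Q)`, set to `0` if `μ(Q) = 0`. -/
def defect {n : ℕ} (μ : Measure (Euc n)) (Q : DyadicCube n) (V : Submodule ℝ (Euc n)) (α : ℝ) :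
    ℝ≥0∞ :=
  if μ Q.toSet = 0 then 0
  else ∑' R : discreteAnnulus Q V α, μ (R : DyadicCube n).toSet / μ Q.toSet

/-- The conical Dini function `G_{μ,X}(x) = ∑_{side Q ≤ 1} Defect(μ, Q, X) χ_Q(x)`, for the bad
cone `X = X(V, α)`. -/
def conicalDini {n : ℕ} (μ : Measure (Euc n)) (V : Submodule ℝ (Euc n)) (α : ℝ) (x : Euc n) :
    ℝ≥0∞ :=
  ∑' Q : {Q : DyadicCube n // Q.side ≤ 1},
    (Q : DyadicCube n).toSet.indicator (fun _ => defect μ (Q : DyadicCube n) V α) x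

end RadonGraphs

end

noncomputable section

namespace RadonGraphs

/-! ### Dyadic cubes -/

namespace DyadicCube

variable {n : ℕ}

/-! Both directions integrate the Dini function `G` over a bounded set and use that `Defect(Q) *
μ(Q)` is the mass of the cubes in the annulus of `Q`.

From a graph `Γ` of an `L`-Lipschitz function over `V`, take `α = 2L + 1`. If `Q` meets `Γ`, every
cube in its annulus has distance from `Γ` comparable to `side Q` (`discreteAnnulus_graph_bounds`),
and its offset from `Q` takes finitely many values. The layers of points at distance about `2⁻ᵏ`
from `Γ` overlap boundedly (`exists_tsum_measure_layer_le`), so the integral of `G` over a bounded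
piece of `Γ` is finite, and `G` is finite almost everywhere there.

Conversely, the planes and apertures vary with the point, so they are first reduced to countably
many: by `badCone_subset_of_norm_sub_le`, narrower cones over nearby planes fit inside the given
ones. Some bounded set `S` of positive measure then has one cone and a bounded Dini function.
Removing from `S` the cubes where `S` is sparse, and the cubes reached from the remaining small
ones, costs less than `μ(S)` (`exists_subset_avoiding`). Points of what is left that share a small
cube never see each other through the cone, so these pieces lie on Lipschitz graphs. -/

instance instCountable : Countable (DyadicCube n) := by
  have h : Function.Injective
      (fun Q : DyadicCube n => ((Q.gen, Q.corner) : ℤ × (Fin n → ℤ))) := by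
    rintro ⟨k, j⟩ ⟨k', j'⟩ h
    simpa using h
  exact h.countable

theorem side_pos (Q : DyadicCube n) : 0 < Q.side := by
  unfold side; positivity

theorem side_le_one_iff (Q : DyadicCube n) : Q.side ≤ 1 ↔ 0 ≤ Q.gen := by
  unfold side
  rw [show (1 : ℝ) = 2 ^ (0 : ℤ) by simp, zpow_le_zpow_iff_right₀ (by norm_num)]
  omega

theorem side_eq_iff {Q R : DyadicCube n} : R.side = Q.side ↔ R.gen = Q.gen := by
  unfold side
  rw [zpow_right_inj₀ (by norm_num) (by norm_num)]
  omega

theorem mem_toSet_iff {Q : DyadicCube n} {x : Euc n} :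
    x ∈ Q.toSet ↔ ∀ i, ⌊x i * (2 : ℝ) ^ Q.gen⌋ = Q.corner i := by
  have h : (0 : ℝ) < 2 ^ Q.gen := by positivity
  simp only [toSet, Set.mem_ofPred_eq, Set.mem_Ico, Int.floor_eq_iff, div_le_iff₀ h, lt_div_iff₀ h]

/-- The dyadic cube of generation `k` that contains `x`. -/
def cubeAt (k : ℤ) (x : Euc n) : DyadicCube n := ⟨k, fun i => ⌊x i * (2 : ℝ) ^ k⌋⟩

theorem mem_cubeAt (k : ℤ) (x : Euc n) : x ∈ (cubeAt k x).toSet :=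
  mem_toSet_iff.2 fun _ => rfl

theorem eq_of_gen_eq {P Q : DyadicCube n} (h : P.gen = Q.gen) {x : Euc n} (hP : x ∈ P.toSet)
    (hQ : x ∈ Q.toSet) : P = Q := by
  obtain ⟨k, j⟩ := P
  obtain ⟨k', j'⟩ := Q
  obtain rfl : k = k' := h
  rw [mem_toSet_iff] at hP hQ
  congr 1
  ext i
  exact (hP i).symm.trans (hQ i)

/-- The index of the coarse cube is the integer quotient of the fine index by a power of two, so the
fine cube determines the coarse one. -/
theorem toSet_subset_of_gen_le {P Q : DyadicCube n} (h : P.gen ≤ Q.gen) {x : Euc n}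
    (hP : x ∈ P.toSet) (hQ : x ∈ Q.toSet) : Q.toSet ⊆ P.toSet := by
  intro y hy
  rw [mem_toSet_iff] at hP hQ hy ⊢
  intro i
  obtain ⟨d, hd⟩ := Int.le.dest h
  have key : ∀ t : ℝ, ⌊t * (2 : ℝ) ^ P.gen⌋ = ⌊t * (2 : ℝ) ^ Q.gen⌋ / ((2 ^ d : ℕ) : ℤ) := by
    intro t
    rw [← Int.floor_div_natCast, ← hd, zpow_add₀ (by norm_num), zpow_natCast]
    push_cast
    congr 1
    field_simp
  rw [← hP i, key, key, hy i, hQ i]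

theorem measurableSet_toSet (Q : DyadicCube n) : MeasurableSet Q.toSet := by
  have h : Q.toSet = ⋂ i, (fun x : Euc n => x i) ⁻¹' (Set.Ico ((Q.corner i : ℝ) / (2 : ℝ) ^ Q.gen)
      (((Q.corner i : ℝ) + 1) / (2 : ℝ) ^ Q.gen)) := by
    ext x
    simp [toSet]
  rw [h]
  refine MeasurableSet.iInter fun i => ?_
  have : Measurable fun x : Euc n => x i :=
    (EuclideanSpace.proj (𝕜 := ℝ) i).continuous.measurable
  exact this measurableSet_Ico

end DyadicCube

theorem norm_le_sqrt_mul {n : ℕ} {v : Euc n} {c : ℝ} (hc : 0 ≤ c) (h : ∀ i, |v i| ≤ c) :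
    ‖v‖ ≤ Real.sqrt n * c := by
  rw [EuclideanSpace.norm_eq]
  refine Real.sqrt_le_iff.2 ⟨by positivity, ?_⟩
  calc ∑ i, ‖v i‖ ^ 2 ≤ ∑ _i : Fin n, c ^ 2 := by
        refine Finset.sum_le_sum fun i _ => ?_
        rw [Real.norm_eq_abs]
        exact pow_le_pow_left₀ (abs_nonneg _) (h i) 2
    _ = (Real.sqrt n * c) ^ 2 := by
        rw [mul_pow, Real.sq_sqrt (by positivity)]
        simp

theorem abs_apply_le_norm {n : ℕ} (v : Euc n) (i : Fin n) : |v i| ≤ ‖v‖ := by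
  simpa using PiLp.norm_apply_le v i

namespace DyadicCube

variable {n : ℕ}

theorem norm_sub_le {Q : DyadicCube n} {x y : Euc n} (hx : x ∈ Q.toSet) (hy : y ∈ Q.toSet) :
    ‖x - y‖ ≤ Real.sqrt n * Q.side := by
  refine norm_le_sqrt_mul Q.side_pos.le fun i => ?_
  have hx := hx i
  have hy := hy i
  have hs : Q.side = 1 / (2 : ℝ) ^ Q.gen := by unfold side; rw [zpow_neg, one_div]
  rw [Set.mem_Ico, add_div, ← hs] at hx hy
  rw [PiLp.sub_apply, abs_le]
  constructor <;> linarith [hx.1, hx.2, hy.1, hy.2]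

theorem center_mem (Q : DyadicCube n) : Q.center ∈ Q.toSet := by
  intro i
  have h : (0 : ℝ) < 2 ^ Q.gen := by positivity
  simp only [center, Set.mem_Ico]
  constructor
  · gcongr; linarith
  · gcongr; norm_num

theorem isBounded_toSet (Q : DyadicCube n) : Bornology.IsBounded Q.toSet := by
  refine Metric.isBounded_iff.2 ⟨Real.sqrt n * Q.side, fun x hx y hy => ?_⟩
  rw [dist_eq_norm]
  exact norm_sub_le hx hy

theorem measure_toSet_lt_top (μ : Measure (Euc n)) [IsFiniteMeasureOnCompacts μ]
    (Q : DyadicCube n) : μ Q.toSet < ⊤ :=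
  Q.isBounded_toSet.measure_lt_top

theorem iUnion_toSet_gen (k : ℤ) :
    ⋃ Q : {Q : DyadicCube n // Q.gen = k}, Q.1.toSet = Set.univ :=
  Set.eq_univ_of_forall fun x => Set.mem_iUnion.2 ⟨⟨cubeAt k x, rfl⟩, mem_cubeAt k x⟩

end DyadicCube

/-! ### Defects and Dini functions of relations between dyadic cubes -/

open Classical in
/-- The defect of `Q` with respect to a relation `D` between dyadic cubes. -/
def relDefect {n : ℕ} (μ : Measure (Euc n)) (D : DyadicCube n → Set (DyadicCube n))
    (Q : DyadicCube n) : ℝ≥0∞ :=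
  if μ Q.toSet = 0 then 0
  else ∑' R : D Q, μ (R : DyadicCube n).toSet / μ Q.toSet

/-- The Dini function of a relation `D` between dyadic cubes. -/
def relDini {n : ℕ} (μ : Measure (Euc n)) (D : DyadicCube n → Set (DyadicCube n)) (x : Euc n) :
    ℝ≥0∞ :=
  ∑' Q : {Q : DyadicCube n // Q.side ≤ 1},
    (Q : DyadicCube n).toSet.indicator (fun _ => relDefect μ D Q) x

section

variable {n : ℕ} (μ : Measure (Euc n)) (D D' : DyadicCube n → Set (DyadicCube n))

theorem conicalDini_eq_relDini (V : Submodule ℝ (Euc n)) (α : ℝ) (x : Euc n) :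
    conicalDini μ V α x = relDini μ (fun Q => discreteAnnulus Q V α) x := rfl

variable {D D'} in
theorem relDini_mono (h : ∀ Q, D Q ⊆ D' Q) (x : Euc n) : relDini μ D x ≤ relDini μ D' x := by
  refine ENNReal.tsum_le_tsum fun Q => Set.indicator_le_indicator ?_
  unfold relDefect
  split_ifs
  · exact le_rfl
  · exact ENNReal.tsum_mono_subtype (fun R : DyadicCube n => μ R.toSet / μ (Q : DyadicCube n).toSet)
      (h Q)

theorem measurable_relDini : Measurable (relDini μ D) :=
  Measurable.tsum fun Q => measurable_const.indicator (Q : DyadicCube n).measurableSet_toSet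

theorem relDefect_mul_measure [IsFiniteMeasureOnCompacts μ] {Q : DyadicCube n}
    (hQ : μ Q.toSet ≠ 0) :
    relDefect μ D Q * μ Q.toSet = ∑' R : D Q, μ (R : DyadicCube n).toSet := by
  rw [relDefect, if_neg hQ, ← ENNReal.tsum_mul_right]
  refine tsum_congr fun R => ?_
  exact ENNReal.div_mul_cancel hQ (Q.measure_toSet_lt_top μ).ne

theorem relDefect_mul_measure_le [IsFiniteMeasureOnCompacts μ] (Q : DyadicCube n) :
    relDefect μ D Q * μ Q.toSet ≤ ∑' R : D Q, μ (R : DyadicCube n).toSet := by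
  by_cases hQ : μ Q.toSet = 0
  · simp [hQ]
  · exact (relDefect_mul_measure μ D hQ).le

theorem lintegral_relDini (S : Set (Euc n)) :
    ∫⁻ x in S, relDini μ D x ∂μ =
      ∑' Q : {Q : DyadicCube n // Q.side ≤ 1}, relDefect μ D Q * μ (Q.1.toSet ∩ S) := by
  unfold relDini
  rw [lintegral_tsum fun Q : {Q : DyadicCube n // Q.side ≤ 1} =>
    (measurable_const.indicator (Q : DyadicCube n).measurableSet_toSet).aemeasurable]
  refine tsum_congr fun Q => ?_
  rw [lintegral_indicator_const Q.1.measurableSet_toSet,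
    Measure.restrict_apply Q.1.measurableSet_toSet]

end

/-! ### Distances to a subspace -/

section

variable {n : ℕ} (V : Submodule ℝ (Euc n))

theorem infDist_eq_norm_sub (x : Euc n) :
    Metric.infDist x (V : Set (Euc n)) = ‖x - V.starProjection x‖ := by
  rw [Submodule.starProjection_minimal, Metric.infDist_eq_iInf]
  exact iInf_congr fun y => dist_eq_norm _ _

theorem sub_starProjection_orthogonal (x : Euc n) :
    x - Vᗮ.starProjection x = V.starProjection x := by
  rw [sub_eq_iff_eq_add, Submodule.starProjection_add_starProjection_orthogonal]

theorem mem_badCone_iff {α : ℝ} {x : Euc n} :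
    x ∈ badCone V α ↔ α * ‖V.starProjection x‖ < ‖x - V.starProjection x‖ := by
  rw [badCone, Set.mem_ofPred_eq, infDist_eq_norm_sub, infDist_eq_norm_sub,
    sub_starProjection_orthogonal]

theorem mem_badConeOn_iff {α : ℝ} {S : Set (Euc n)} {y : Euc n} :
    y ∈ badConeOn V α S ↔ ∃ x ∈ S, y - x ∈ badCone V α := by
  simp only [badConeOn, Set.mem_iUnion, Set.mem_image, exists_prop]
  refine exists_congr fun x => and_congr_right fun _ => ?_
  exact ⟨fun ⟨w, hw, h⟩ => by rwa [← h, add_sub_cancel_left], fun h => ⟨y - x, h, by abel⟩⟩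

end


/-! ### Removing cubes from a set with integrable Dini function -/

section

variable {n : ℕ} (μ : Measure (Euc n))

/-- A weak type estimate for the cubes in which `S` has small relative measure. -/
theorem measure_inter_iUnion_sparse_le {S : Set (Euc n)} {Q₀ : DyadicCube n} (hQ₀ : Q₀.gen = 0)
    (hS : S ⊆ Q₀.toSet) (δ : ℝ≥0∞) :
    μ (S ∩ ⋃ Q ∈ {Q : DyadicCube n | 0 ≤ Q.gen ∧ μ (Q.toSet ∩ S) ≤ δ * μ Q.toSet}, Q.toSet) ≤
      δ * μ Q₀.toSet := by
  set bad : Set (DyadicCube n) :=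
    {Q : DyadicCube n | 0 ≤ Q.gen ∧ μ (Q.toSet ∩ S) ≤ δ * μ Q.toSet} with hbad
  -- The maximal sparse cubes that meet `S`. They exist because generations are bounded below by
  -- `0`; they are disjoint and lie in `Q₀`, so the sparseness bounds add up.
  set top : Set (DyadicCube n) := {Q | Q ∈ bad ∧ (Q.toSet ∩ S).Nonempty ∧
    ∀ P ∈ bad, (P.toSet ∩ Q.toSet).Nonempty → Q.gen ≤ P.gen} with htop
  have hcover : S ∩ ⋃ Q ∈ bad, Q.toSet ⊆ ⋃ Q ∈ top, Q.toSet ∩ S := by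
    classical
    rintro x ⟨hxS, hx⟩
    simp only [Set.mem_iUnion, exists_prop] at hx
    have hex : ∃ k : ℕ, ∃ Q ∈ bad, x ∈ Q.toSet ∧ Q.gen = k := by
      obtain ⟨Q, hQ, hxQ⟩ := hx
      exact ⟨Q.gen.toNat, Q, hQ, hxQ, (Int.toNat_of_nonneg hQ.1).symm⟩
    obtain ⟨Q, hQ, hxQ, hgen⟩ := Nat.find_spec hex
    simp only [Set.mem_iUnion, exists_prop]
    refine ⟨Q, ⟨hQ, ⟨x, hxQ, hxS⟩, fun P hP hPQ => ?_⟩, hxQ, hxS⟩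
    by_contra! hlt
    obtain ⟨y, hyP, hyQ⟩ := hPQ
    have hxP : x ∈ P.toSet := DyadicCube.toSet_subset_of_gen_le hlt.le hyP hyQ hxQ
    have h0 := hP.1
    exact Nat.find_min hex (m := P.gen.toNat) (by omega)
      ⟨P, hP, hxP, (Int.toNat_of_nonneg h0).symm⟩
  have hdisj : top.PairwiseDisjoint DyadicCube.toSet := by
    intro P hP Q hQ hne
    by_contra h
    obtain ⟨x, hxP, hxQ⟩ := Set.not_disjoint_iff.1 h
    exact hne (DyadicCube.eq_of_gen_eq
      (le_antisymm (hP.2.2 Q hQ.1 ⟨x, hxQ, hxP⟩) (hQ.2.2 P hP.1 ⟨x, hxP, hxQ⟩)) hxP hxQ)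
  have hsub : ⋃ Q ∈ top, Q.toSet ⊆ Q₀.toSet := by
    refine Set.iUnion₂_subset fun Q hQ => ?_
    obtain ⟨x, hxQ, hxS⟩ := hQ.2.1
    exact DyadicCube.toSet_subset_of_gen_le (hQ₀.trans_le hQ.1.1) (hS hxS) hxQ
  calc μ (S ∩ ⋃ Q ∈ bad, Q.toSet) ≤ μ (⋃ Q ∈ top, Q.toSet ∩ S) := measure_mono hcover
    _ ≤ ∑' Q : top, μ (Q.1.toSet ∩ S) := measure_biUnion_le μ (Set.to_countable _) _
    _ ≤ ∑' Q : top, δ * μ Q.1.toSet := ENNReal.tsum_le_tsum fun Q => Q.2.1.2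
    _ = δ * μ (⋃ Q ∈ top, Q.toSet) := by
        rw [ENNReal.tsum_mul_left, measure_biUnion (Set.to_countable _) hdisj
          fun Q _ => Q.measurableSet_toSet]
    _ ≤ δ * μ Q₀.toSet := by gcongr

/-- If the Dini function of `D` is integrable on `S`, then some subset of `S` of positive measure
avoids the cubes related to the small cubes that it meets. -/
theorem exists_subset_avoiding [IsFiniteMeasureOnCompacts μ]
    {D : DyadicCube n → Set (DyadicCube n)} {S : Set (Euc n)} {Q₀ : DyadicCube n}
    (hQ₀ : Q₀.gen = 0) (hS : S ⊆ Q₀.toSet) (hpos : 0 < μ S)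
    (hfin : ∫⁻ x in S, relDini μ D x ∂μ ≠ ⊤) :
    ∃ T ⊆ S, 0 < μ T ∧ ∃ k : ℤ, ∀ Q : DyadicCube n, k ≤ Q.gen →
      (Q.toSet ∩ T).Nonempty → ∀ R ∈ D Q, Disjoint R.toSet T := by
  classical
  have hhalf : μ S / 2 ≠ 0 := (ENNReal.half_pos hpos.ne').ne'
  obtain ⟨δ, hδ, hδS⟩ := ENNReal.exists_nnreal_pos_mul_lt (Q₀.measure_toSet_lt_top μ).ne hhalf
  have hδ0 : (δ : ℝ≥0∞) ≠ 0 := by exact_mod_cast hδ.ne'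
  set B : Set (Euc n) := ⋃ Q ∈ {Q : DyadicCube n | 0 ≤ Q.gen ∧
    μ (Q.toSet ∩ S) ≤ δ * μ Q.toSet}, Q.toSet with hB
  have hμB : μ (S ∩ B) < μ S / 2 := (measure_inter_iUnion_sparse_le μ hQ₀ hS δ).trans_lt hδS
  -- The mass to be removed on account of a non-sparse `Q`. There `μ(Q) ≤ δ⁻¹ μ(Q ∩ S)`, so the sum
  -- is at most `δ⁻¹` times the integral. Null cubes count as sparse, hence the default value of the
  -- defect never enters.
  let f : {Q : DyadicCube n // Q.side ≤ 1} → ℝ≥0∞ := fun Q =>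
    if μ (Q.1.toSet ∩ S) ≤ δ * μ Q.1.toSet then 0 else ∑' R : D Q.1, μ (R : DyadicCube n).toSet
  have hf : ∑' Q, f Q ≠ ⊤ := by
    have hle : ∑' Q, f Q ≤ (δ : ℝ≥0∞)⁻¹ * ∫⁻ x in S, relDini μ D x ∂μ := by
      rw [lintegral_relDini, ← ENNReal.tsum_mul_left]
      refine ENNReal.tsum_le_tsum fun Q => ?_
      simp only [f]
      split_ifs with h
      · exact zero_le
      · have h0 : μ Q.1.toSet ≠ 0 := by
          intro h0
          exact h (by rw [h0, mul_zero]; exact (measure_mono Set.inter_subset_left).trans h0.le)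
        rw [← relDefect_mul_measure μ D h0, mul_left_comm]
        gcongr
        rw [mul_comm, ← div_eq_mul_inv, ENNReal.le_div_iff_mul_le (Or.inl hδ0)
          (Or.inl ENNReal.coe_ne_top), mul_comm]
        exact (not_le.1 h).le
    exact (hle.trans_lt (ENNReal.mul_lt_top (by simpa using hδ) hfin.lt_top)).ne
  obtain ⟨s, hs⟩ := ((tendsto_order.1 (ENNReal.tendsto_tsum_compl_atTop_zero hf)).2 _
    (pos_iff_ne_zero.2 hhalf)).exists
  obtain ⟨M, hM⟩ := (s.image fun Q => Q.1.gen).exists_le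
  set U : Set (Euc n) := ⋃ Q : {Q // Q ∉ s}, ⋃ (_ : ¬ μ (Q.1.1.toSet ∩ S) ≤ δ * μ Q.1.1.toSet),
    ⋃ R : D Q.1.1, R.1.toSet with hU
  have hμU : μ U < μ S / 2 := by
    refine lt_of_le_of_lt ((measure_iUnion_le _).trans (ENNReal.tsum_le_tsum fun Q => ?_)) hs
    simp only [f]
    split_ifs with h
    · simp [h]
    · simpa [h] using measure_iUnion_le (μ := μ) fun R : D Q.1.1 => R.1.toSet
  -- Beyond generation `M` no cube belongs to the finite set `s`, whose related cubes were not
  -- removed; the `0` keeps sides at most `1`.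
  refine ⟨S \ (B ∪ U), Set.sdiff_subset, ?_, max 0 (M + 1), ?_⟩
  · by_contra! h
    have : μ S ≤ μ (S ∩ B) + μ U := by
      calc μ S ≤ μ (S \ (B ∪ U) ∪ (S ∩ B ∪ U)) := by
            refine measure_mono fun x hx => ?_
            by_cases h1 : x ∈ B <;> by_cases h2 : x ∈ U <;> simp [hx, h1, h2]
        _ ≤ μ (S \ (B ∪ U)) + μ (S ∩ B ∪ U) := measure_union_le _ _
        _ ≤ 0 + (μ (S ∩ B) + μ U) := add_le_add h (measure_union_le _ _)
        _ = _ := zero_add _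
    have h2 := this.trans_lt (ENNReal.add_lt_add hμB hμU)
    rw [ENNReal.add_halves] at h2
    exact lt_irrefl _ h2
  · rintro Q hQ ⟨x, hxQ, hxS, hx⟩ R hR
    have hgen : 0 ≤ Q.gen := (le_max_left _ _).trans hQ
    have hgood : ¬ μ (Q.toSet ∩ S) ≤ δ * μ Q.toSet := fun h =>
      hx (Or.inl (Set.mem_biUnion (show Q ∈ {Q : DyadicCube n | 0 ≤ Q.gen ∧
        μ (Q.toSet ∩ S) ≤ δ * μ Q.toSet} from ⟨hgen, h⟩) hxQ))
    have hQs : (⟨Q, Q.side_le_one_iff.2 hgen⟩ : {Q : DyadicCube n // Q.side ≤ 1}) ∉ s := by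
      intro h
      have h1 := hM _ (Finset.mem_image_of_mem _ h)
      have h2 := (le_max_right _ _).trans hQ
      simp only at h1
      omega
    rw [Set.disjoint_left]
    rintro y hyR ⟨-, hy⟩
    refine hy (Or.inr ?_)
    simp only [hU, Set.mem_iUnion]
    exact ⟨⟨_, hQs⟩, hgood, ⟨R, hR⟩, hyR⟩

end


/-! ### Lipschitz graphs from cone conditions -/

section

variable {n : ℕ}

/-- Outside the cone, the component of a difference orthogonal to `V` is at most `β` times its
component in `V`. So the projection to `V` is injective on `F`, and the orthogonal component is a
`β`-Lipschitz function of it; this extends to all of `V`, possibly with a larger constant. -/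
theorem exists_lipschitz_graph_of_cone (V : Submodule ℝ (Euc n)) {β : ℝ} (hβ : 0 ≤ β)
    {F : Set (Euc n)} (hF : ∀ x ∈ F, ∀ y ∈ F, y - x ∉ badCone V β) :
    ∃ f : V → Vᗮ, (∃ L : ℝ≥0, LipschitzWith L f) ∧ F ⊆ graph V f := by
  have hF' : ∀ x ∈ F, ∀ y ∈ F, ‖(y - x) - V.starProjection (y - x)‖ ≤
      β * ‖V.starProjection (y - x)‖ := fun x hx y hy =>
    not_lt.1 (mt (mem_badCone_iff V).2 (hF x hx y hy))
  let p : Euc n → V := fun x => V.orthogonalProjectionOnto x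
  have hp : ∀ x, ((p x : V) : Euc n) = V.starProjection x := fun x => rfl
  let g : V → Euc n := Function.invFunOn p F
  have hg : ∀ x ∈ F, g (p x) = x := by
    intro x hx
    have hmem : g (p x) ∈ F := Function.invFunOn_mem ⟨x, hx, rfl⟩
    have hpg : p (g (p x)) = p x := Function.invFunOn_eq ⟨x, hx, rfl⟩
    have h0 : V.starProjection (g (p x) - x) = 0 := by
      rw [map_sub, ← hp, ← hp, hpg, sub_self]
    have h1 := hF' x hx _ hmem
    rw [h0, norm_zero, mul_zero, sub_zero] at h1
    exact sub_eq_zero.1 (norm_le_zero_iff.1 h1)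
  let q : V → Vᗮ := fun v => Vᗮ.orthogonalProjectionOnto (g v)
  have hq : ∀ x ∈ F, ((q (p x) : Vᗮ) : Euc n) = x - V.starProjection x := by
    intro x hx
    simp only [q, hg x hx]
    change Vᗮ.starProjection x = _
    rw [Submodule.starProjection_orthogonal]
    rfl
  have hlip : LipschitzOnWith β.toNNReal q (p '' F) := by
    refine LipschitzOnWith.of_dist_le_mul ?_
    rintro _ ⟨x, hx, rfl⟩ _ ⟨y, hy, rfl⟩
    rw [dist_eq_norm, dist_eq_norm, Real.coe_toNNReal β hβ]
    change ‖((q (p x) : Vᗮ) : Euc n) - ((q (p y) : Vᗮ) : Euc n)‖ ≤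
      β * ‖((p x : V) : Euc n) - ((p y : V) : Euc n)‖
    rw [hq x hx, hq y hy, hp, hp, ← map_sub]
    convert hF' y hy x hx using 2
    rw [map_sub]
    abel
  obtain ⟨f, hf, hfq⟩ := hlip.extend_finite_dimension
  refine ⟨f, ⟨_, hf⟩, fun x hx => ⟨p x, ?_⟩⟩
  simp only
  rw [← hfq ⟨x, hx, rfl⟩, hq x hx, hp]
  abel

/-- The cubes of the generation of `Q` that are reached from `Q` through the cone `X(V, β)` at
distances between `a side Q` and `2 a side Q`. -/
def reachedCubes (V : Submodule ℝ (Euc n)) (β a : ℝ) (Q : DyadicCube n) : Set (DyadicCube n) :=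
  {R | R.gen = Q.gen ∧ ∃ x ∈ Q.toSet, ∃ y ∈ R.toSet, y - x ∈ badCone V β ∧
    a * Q.side ≤ ‖y - x‖ ∧ ‖y - x‖ ≤ 2 * a * Q.side}

/-- In units of `√n max(α, 1/α) side Q` the annulus has radii `27` and `81`. Measuring from a point
of `Q` instead of the center costs at most one unit, whence `28` and `2 * 40`. The free parameter
`a` can be rational, and the ratio `2` lets consecutive generations cover all distances. -/
theorem reachedCubes_subset_discreteAnnulus {V V' : Submodule ℝ (Euc n)} {α β a : ℝ}
    (h : badCone V' β ⊆ badCone V α) (ha : 28 * Real.sqrt n * max α (1 / α) ≤ a)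
    (ha' : a ≤ 40 * Real.sqrt n * max α (1 / α)) (hM : 1 ≤ max α (1 / α)) (Q : DyadicCube n) :
    reachedCubes V' β a Q ⊆ discreteAnnulus Q V α := by
  rintro R ⟨hR, x, hx, y, hy, hxy, h1, h2⟩
  have hs := Q.side_pos
  have hxc := DyadicCube.norm_sub_le hx Q.center_mem
  have hsqrt : 0 ≤ Real.sqrt n * Q.side := by positivity
  have hMs : Real.sqrt n * Q.side ≤ Real.sqrt n * Q.side * max α (1 / α) :=
    le_mul_of_one_le_right hsqrt hM
  have ha1 := mul_le_mul_of_nonneg_right ha hs.le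
  have ha2 := mul_le_mul_of_nonneg_right ha' hs.le
  have e : y - Q.center = (y - x) + (x - Q.center) := by abel
  refine ⟨DyadicCube.side_eq_iff.2 hR, y, hy, ⟨(mem_badConeOn_iff V).2 ⟨x, hx, h hxy⟩, ?_⟩, ?_⟩
  · rw [Metric.mem_closedBall, dist_eq_norm, e, coneRadius]
    have := norm_add_le (y - x) (x - Q.center)
    nlinarith
  · rw [Metric.mem_ball, dist_eq_norm, not_lt, e, coneRadius]
    have := norm_sub_le_norm_add (y - x) (x - Q.center)
    nlinarith

/-- A set that avoids the cubes reached from the small cubes that it meets is locally contained in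
a Lipschitz graph. -/
theorem not_mem_badCone_of_avoiding {V : Submodule ℝ (Euc n)} {β a : ℝ}
    (ha : Real.sqrt n ≤ a) (ha0 : 0 < a) {T : Set (Euc n)} {k : ℤ}
    (hT : ∀ Q : DyadicCube n, k ≤ Q.gen →
      (Q.toSet ∩ T).Nonempty → ∀ R ∈ reachedCubes V β a Q, Disjoint R.toSet T)
    {Q : DyadicCube n} (hQ : Q.gen = k) {x y : Euc n} (hx : x ∈ T ∩ Q.toSet)
    (hy : y ∈ T ∩ Q.toSet) : y - x ∉ badCone V β := by
  intro hxy
  have hne : 0 < ‖y - x‖ := by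
    rw [norm_pos_iff]
    intro h0
    rw [h0, mem_badCone_iff] at hxy
    simp at hxy
  have hd : 0 < ‖y - x‖ / a := by positivity
  -- This is the scale with `a 2ˡ ≤ ‖y - x‖ < 2a 2ˡ`, so the cube of side `2ˡ` at `x` reaches the
  -- one at `y`. Since `√n ≤ a`, a common cube of generation `k` forces `l ≤ -k`.
  set l := Int.log 2 (‖y - x‖ / a) with hl
  have h1 : (2 : ℝ) ^ l ≤ ‖y - x‖ / a := by
    exact_mod_cast Int.zpow_log_le_self (b := 2) (by norm_num) hd
  have h2 : ‖y - x‖ / a < (2 : ℝ) ^ (l + 1) := by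
    exact_mod_cast Int.lt_zpow_succ_log_self (b := 2) (by norm_num) (‖y - x‖ / a)
  have hk : l ≤ -k := by
    have h3 : ‖y - x‖ ≤ a * (2 : ℝ) ^ (-k) := by
      have h4 := DyadicCube.norm_sub_le hy.2 hx.2
      rw [DyadicCube.side, hQ] at h4
      exact h4.trans (by gcongr)
    have h5 : (2 : ℝ) ^ l ≤ 2 ^ (-k) := h1.trans ((div_le_iff₀' ha0).2 h3)
    exact (zpow_le_zpow_iff_right₀ (by norm_num)).1 h5
  let P := DyadicCube.cubeAt (-l) x
  let R := DyadicCube.cubeAt (-l) y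
  have hside : P.side = 2 ^ l := by simp [P, DyadicCube.cubeAt, DyadicCube.side]
  have hR : R ∈ reachedCubes V β a P := by
    refine ⟨rfl, x, DyadicCube.mem_cubeAt _ _, y, DyadicCube.mem_cubeAt _ _, hxy, ?_, ?_⟩
    · rw [hside]
      exact (le_div_iff₀' ha0).1 h1
    · rw [hside]
      rw [div_lt_iff₀' ha0, zpow_add_one₀ (by norm_num)] at h2
      linarith
  have hPk : k ≤ P.gen := by
    change k ≤ -l
    omega
  exact Set.disjoint_left.1 (hT P hPk ⟨x, DyadicCube.mem_cubeAt _ _, hx.1⟩ R hR)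
    (DyadicCube.mem_cubeAt _ _) hy.1

/-- Cones over nearby planes are nested, if the inner aperture is narrower. -/
theorem badCone_subset_of_norm_sub_le {V V' : Submodule ℝ (Euc n)} {α β ε : ℝ} (hα : 0 < α)
    (hβ : 0 < β) (hε : ‖V.starProjection - V'.starProjection‖ ≤ ε)
    (h : α / β + ε * (1 + α) * (1 + 1 / β) ≤ 1) : badCone V' β ⊆ badCone V α := by
  intro x hx
  rw [mem_badCone_iff] at hx ⊢
  set u := ‖x - V'.starProjection x‖ with hu
  set w := ‖V'.starProjection x‖ with hw
  have hε0 : 0 ≤ ε := (norm_nonneg _).trans hε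
  have hw0 : 0 ≤ w := norm_nonneg _
  have hwu : w < u / β := by rw [lt_div_iff₀' hβ]; exact hx
  have hu0 : 0 < u := (by positivity : 0 ≤ β * w).trans_lt hx
  have hxn : ‖x‖ ≤ (1 + 1 / β) * u := by
    have h1 : ‖x‖ ≤ u + w := by
      simpa [hu, hw] using norm_add_le (x - V'.starProjection x) (V'.starProjection x)
    calc ‖x‖ ≤ u + w := h1
      _ ≤ u + u / β := by gcongr
      _ = (1 + 1 / β) * u := by ring
  have hdiff : ‖V.starProjection x - V'.starProjection x‖ ≤ ε * ((1 + 1 / β) * u) := by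
    calc ‖V.starProjection x - V'.starProjection x‖
        = ‖(V.starProjection - V'.starProjection) x‖ := rfl
      _ ≤ ‖V.starProjection - V'.starProjection‖ * ‖x‖ := ContinuousLinearMap.le_opNorm _ _
      _ ≤ ε * ((1 + 1 / β) * u) := by gcongr
  -- Changing the plane moves each of the two components of `x` by at most `t`.
  set t := ε * ((1 + 1 / β) * u) with ht
  have h1 : ‖V.starProjection x‖ ≤ w + t := by
    have := norm_add_le (V'.starProjection x) (V.starProjection x - V'.starProjection x)
    rw [add_sub_cancel] at this
    linarith
  have h2 : u - t ≤ ‖x - V.starProjection x‖ := by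
    have := norm_sub_norm_le (x - V'.starProjection x) (V.starProjection x - V'.starProjection x)
    rw [show x - V'.starProjection x - (V.starProjection x - V'.starProjection x) =
      x - V.starProjection x by abel] at this
    linarith
  calc α * ‖V.starProjection x‖ ≤ α * (w + t) := by gcongr
    _ < α * (u / β + t) := by gcongr
    _ = (α / β + ε * (1 + α) * (1 + 1 / β)) * u - t := by rw [ht]; ring
    _ ≤ 1 * u - t := by gcongr
    _ ≤ ‖x - V.starProjection x‖ := by rw [one_mul]; exact h2

end


/-! ### From finite Dini functions to a Lipschitz graph -/

section

variable {n m : ℕ}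

/-- There are countably many planes that can replace an arbitrary plane, up to a slight narrowing
of its cones. -/
theorem exists_countable_planes (n m : ℕ) :
    ∃ 𝒱 : Set (Submodule ℝ (Euc n)), 𝒱.Countable ∧ (∀ V ∈ 𝒱, Module.finrank ℝ V = m) ∧
      ∀ V : Submodule ℝ (Euc n), Module.finrank ℝ V = m → ∀ ε : ℝ, 0 < ε →
        ∃ V' ∈ 𝒱, ‖V.starProjection - V'.starProjection‖ < ε := by
  let p : {V : Submodule ℝ (Euc n) // Module.finrank ℝ V = m} → (Euc n →L[ℝ] Euc n) :=
    fun V => V.1.starProjection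
  -- The dense subset is taken inside the set of projections, so its members come from `m`-planes.
  obtain ⟨t, hts, htc, htd⟩ :=
    (TopologicalSpace.IsSeparable.of_separableSpace (Set.range p)).exists_countable_dense_subset
  choose g hg using fun A : t => hts A.2
  have : Countable t := htc.to_subtype
  refine ⟨Set.range fun A => (g A).1, Set.countable_range _, ?_, fun V hV ε hε => ?_⟩
  · rintro _ ⟨A, rfl⟩
    exact (g A).2
  · obtain ⟨A, hA, hdist⟩ := Metric.mem_closure_iff.1 (htd ⟨⟨V, hV⟩, rfl⟩) ε hε
    refine ⟨_, ⟨⟨A, hA⟩, rfl⟩, ?_⟩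
    have h1 : (g ⟨A, hA⟩).1.starProjection = A := hg ⟨A, hA⟩
    simp only [h1]
    rw [← dist_eq_norm]
    exact hdist

/-- No measurability of `E` or of the choice of planes is needed: `E` is covered by countably many
measurable sets, indexed by plane, aperture, distance parameter, bound and unit cube. -/
theorem exists_lipschitz_graph_of_conicalDini (μ : Measure (Euc n)) [IsFiniteMeasureOnCompacts μ]
    (hn : 0 < n) {E : Set (Euc n)} (hE : 0 < μ E)
    (h : ∀ x ∈ E, ∃ V : Submodule ℝ (Euc n), Module.finrank ℝ V = m ∧
      ∃ α : ℝ, 0 < α ∧ conicalDini μ V α x < ⊤) :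
    ∃ Γ : Set (Euc n), IsLipschitzGraph m Γ ∧ 0 < μ Γ := by
  obtain ⟨𝒱, hcount, hdim, hdense⟩ := exists_countable_planes n m
  have : Countable 𝒱 := hcount.to_subtype
  let J := {j : 𝒱 × ℚ × ℚ // 0 < (j.2.1 : ℝ) ∧ Real.sqrt n ≤ (j.2.2 : ℝ)}
  let D : J → DyadicCube n → Set (DyadicCube n) := fun j =>
    reachedCubes j.1.1 (j.1.2.1 : ℝ) (j.1.2.2 : ℝ)
  let S : J × ℕ × {Q : DyadicCube n // Q.gen = 0} → Set (Euc n) := fun i =>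
    {x | relDini μ (D i.1) x ≤ i.2.1} ∩ i.2.2.1.toSet
  have hsqrt : 0 < Real.sqrt n := Real.sqrt_pos.2 (by exact_mod_cast hn)
  have hcover : E ⊆ ⋃ i, S i := by
    intro x hx
    obtain ⟨V, hV, α, hα, hG⟩ := h x hx
    have hM : 1 ≤ max α (1 / α) := by
      rcases le_total 1 α with h1 | h1
      · exact h1.trans (le_max_left _ _)
      · exact ((one_le_div hα).2 h1).trans (le_max_right _ _)
    -- With `β > 2α` and the `ε` below, each summand in the hypothesis of
    -- `badCone_subset_of_norm_sub_le` is at most `1/2`.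
    obtain ⟨β, hβ⟩ := exists_rat_gt (2 * α)
    have hβ0 : (0 : ℝ) < β := by linarith
    obtain ⟨a, ha1, ha2⟩ := exists_rat_btwn (show 28 * Real.sqrt n * max α (1 / α) <
      40 * Real.sqrt n * max α (1 / α) by
        have : 0 < Real.sqrt n * max α (1 / α) := by positivity
        nlinarith)
    set ε : ℝ := 1 / (2 * ((1 + α) * (1 + 1 / β))) with hε
    have hK : 0 < (1 + α) * (1 + 1 / (β : ℝ)) := by positivity
    obtain ⟨V', hV', hVV⟩ := hdense V hV ε (by positivity)
    have hcone : badCone V' β ⊆ badCone V α := by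
      refine badCone_subset_of_norm_sub_le hα hβ0 hVV.le ?_
      have h1 : α / β ≤ 1 / 2 := by
        rw [div_le_iff₀ hβ0]
        linarith
      have h2 : ε * (1 + α) * (1 + 1 / (β : ℝ)) = 1 / 2 := by
        rw [hε, mul_assoc]
        field_simp
      linarith
    have hasq : Real.sqrt n ≤ (a : ℝ) := by
      have : Real.sqrt n ≤ Real.sqrt n * max α (1 / α) := le_mul_of_one_le_right hsqrt.le hM
      nlinarith
    let j : J := ⟨(⟨V', hV'⟩, β, a), hβ0, hasq⟩
    have hD : relDini μ (D j) x < ⊤ := by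
      refine lt_of_le_of_lt ?_ hG
      rw [conicalDini_eq_relDini]
      exact relDini_mono μ (reachedCubes_subset_discreteAnnulus hcone ha1.le ha2.le hM) x
    obtain ⟨N, hN⟩ := ENNReal.exists_nat_gt hD.ne
    exact Set.mem_iUnion.2 ⟨(j, N, ⟨DyadicCube.cubeAt 0 x, rfl⟩), hN.le,
      DyadicCube.mem_cubeAt 0 x⟩
  obtain ⟨⟨j, N, Q₀⟩, hi⟩ := exists_measure_pos_of_not_measure_iUnion_null (μ := μ) (s := S)
    (hE.trans_le (measure_mono hcover)).ne'
  have hint : ∫⁻ x in S (j, N, Q₀), relDini μ (D j) x ∂μ ≠ ⊤ := by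
    have hfin : μ (S (j, N, Q₀)) < ⊤ :=
      (measure_mono Set.inter_subset_right).trans_lt (Q₀.1.measure_toSet_lt_top μ)
    have hSm : MeasurableSet (S (j, N, Q₀)) :=
      ((measurable_relDini μ (D j)) measurableSet_Iic).inter Q₀.1.measurableSet_toSet
    refine ((setLIntegral_mono' hSm fun x hx => hx.1).trans_lt ?_).ne
    rw [setLIntegral_const]
    exact ENNReal.mul_lt_top (ENNReal.natCast_lt_top N) hfin
  obtain ⟨T, -, hT, k, hk⟩ := exists_subset_avoiding μ Q₀.2 Set.inter_subset_right hi hint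
  have hTcover : T ⊆ ⋃ Q : {Q : DyadicCube n // Q.gen = k}, T ∩ Q.1.toSet := by
    rw [← Set.inter_iUnion, DyadicCube.iUnion_toSet_gen, Set.inter_univ]
  obtain ⟨Q, hQ⟩ := exists_measure_pos_of_not_measure_iUnion_null
    (hT.trans_le (measure_mono hTcover)).ne'
  obtain ⟨f, hf, hsub⟩ := exists_lipschitz_graph_of_cone j.1.1.1 j.2.1.le
    (F := T ∩ Q.1.toSet) fun x hx y hy =>
      not_mem_badCone_of_avoiding j.2.2 (hsqrt.trans_le j.2.2) hk Q.2 hx hy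
  exact ⟨_, ⟨j.1.1.1, hdim _ j.1.1.2, f, hf, rfl⟩, hQ.trans_le (measure_mono hsub)⟩

end


/-! ### Finiteness of the Dini function on Lipschitz graphs -/

section

variable {n : ℕ}

theorem norm_sub_starProjection_le (V : Submodule ℝ (Euc n)) (x : Euc n) :
    ‖x - V.starProjection x‖ ≤ ‖x‖ := by
  have h := Submodule.norm_starProjection_apply_le Vᗮ x
  rw [Submodule.starProjection_orthogonal] at h
  exact h

theorem norm_sub_starProjection_le_of_mem_graph {V : Submodule ℝ (Euc n)} {f : V → Vᗮ} {L : ℝ≥0}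
    (hf : LipschitzWith L f) {x y : Euc n} (hx : x ∈ graph V f) (hy : y ∈ graph V f) :
    ‖(x - y) - V.starProjection (x - y)‖ ≤ L * ‖V.starProjection (x - y)‖ := by
  have key : ∀ v : V, V.starProjection ((v : Euc n) + (f v : Euc n)) = v := by
    intro v
    rw [map_add, Submodule.starProjection_eq_self_iff.2 v.2,
      (Submodule.starProjection_apply_eq_zero_iff V).2 (f v).2, add_zero]
  obtain ⟨v, rfl⟩ := hx
  obtain ⟨w, rfl⟩ := hy
  simp only
  rw [map_sub, key, key]
  have h := hf.dist_le_mul v w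
  rw [dist_eq_norm, dist_eq_norm] at h
  change ‖(f v : Euc n) - (f w : Euc n)‖ ≤ L * ‖(v : Euc n) - (w : Euc n)‖ at h
  convert h using 2
  abel

/-- The cubes in the discretized annulus of a cube that meets a Lipschitz graph have a distance to
the graph that is comparable to their side length. -/
theorem discreteAnnulus_graph_bounds (hn : 0 < n) {V : Submodule ℝ (Euc n)} {f : V → Vᗮ} {L : ℝ≥0}
    (hf : LipschitzWith L f) {Q R : DyadicCube n} {g y : Euc n} (hg : g ∈ graph V f)
    (hgQ : g ∈ Q.toSet) (hR : R ∈ discreteAnnulus Q V (2 * L + 1)) (hy : y ∈ R.toSet) :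
    Q.side ≤ Metric.infDist y (graph V f) ∧
      ‖y - g‖ ≤ Real.sqrt n * (81 * (2 * L + 1) + 2) * Q.side := by
  obtain ⟨hside, z, hzR, ⟨hzX, hzB⟩, hzU⟩ := hR
  obtain ⟨q, hq, hw⟩ := (mem_badConeOn_iff V).1 hzX
  rw [mem_badCone_iff] at hw
  have hL : (0 : ℝ) ≤ L := L.2
  have hmax : max (2 * (L : ℝ) + 1) (1 / (2 * L + 1)) = 2 * L + 1 := by
    refine max_eq_left ?_
    rw [div_le_iff₀ (by positivity)]
    nlinarith
  rw [Metric.mem_closedBall, dist_eq_norm, coneRadius, hmax] at hzB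
  rw [Metric.mem_ball, not_lt, dist_eq_norm, coneRadius, hmax] at hzU
  have hs := Q.side_pos
  have hsqrt : 1 ≤ Real.sqrt n := Real.one_le_sqrt.2 (by exact_mod_cast hn)
  set σ := Real.sqrt n * Q.side with hσ
  have hsσ : Q.side ≤ σ := le_mul_of_one_le_left hs.le hsqrt
  have hyz : ‖y - z‖ ≤ σ := by
    have := DyadicCube.norm_sub_le hy hzR
    rwa [hside] at this
  have hqg := DyadicCube.norm_sub_le hq hgQ
  have hcg := DyadicCube.norm_sub_le Q.center_mem hgQ
  have hcq := DyadicCube.norm_sub_le hq Q.center_mem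
  rw [← hσ] at hqg hcg hcq
  constructor
  · rw [Metric.le_infDist ⟨g, hg⟩]
    intro γ hγ
    rw [dist_eq_norm]
    have hh := norm_sub_starProjection_le_of_mem_graph hf hγ hg
    set P := V.starProjection with hP
    have hzc : ‖z - Q.center‖ ≤ ‖z - q‖ + ‖q - Q.center‖ := norm_sub_le_norm_sub_add_norm_sub ..
    -- The cone vector `z - q` is compared with the graph vector `γ - g`. The former is long and
    -- steeper than `2L + 1`, the latter at most `L` steep, so their difference `ζ` has norm at
    -- least `13σ/2`. As `ζ` differs from `y - γ` by at most `2σ`, this leaves more than `side Q`.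
    have hwn : ‖z - q‖ ≤ ‖(z - q) - P (z - q)‖ + ‖P (z - q)‖ := by
      simpa using norm_add_le ((z - q) - P (z - q)) (P (z - q))
    set ζ := (z - q) - (γ - g) with hζ
    have hζn : ‖ζ‖ ≤ ‖y - γ‖ + 2 * σ := by
      have e : ζ = (y - γ) - ((y - z) + (q - g)) := by rw [hζ]; abel
      rw [e]
      have h1 := norm_sub_le (y - γ) ((y - z) + (q - g))
      have h2 := norm_add_le (y - z) (q - g)
      linarith
    have h1 : ‖(z - q) - P (z - q)‖ ≤ ‖(γ - g) - P (γ - g)‖ + ‖ζ‖ := by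
      have e : (z - q) - P (z - q) = ((γ - g) - P (γ - g)) + (ζ - P ζ) := by
        rw [hζ, map_sub P (z - q)]; abel
      rw [e]
      exact (norm_add_le _ _).trans (by gcongr; exact norm_sub_starProjection_le V ζ)
    have h2 : ‖P (γ - g)‖ ≤ ‖P (z - q)‖ + ‖ζ‖ := by
      have e : P (γ - g) = P (z - q) - P ζ := by rw [hζ, map_sub P (z - q)]; abel
      rw [e]
      exact (norm_sub_le _ _).trans
        (by gcongr; exact Submodule.norm_starProjection_apply_le V ζ)
    set u := ‖(z - q) - P (z - q)‖
    set p := ‖P (z - q)‖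
    have hp : 0 ≤ p := norm_nonneg _
    have hpu : p ≤ u := by nlinarith
    have hu : 13 * ((2 * L + 1) * σ) ≤ u := by nlinarith
    have h3 : u ≤ L * (p + ‖ζ‖) + ‖ζ‖ := by
      have := mul_le_mul_of_nonneg_left h2 hL
      linarith
    have h4 : u ≤ 2 * ((1 + L) * ‖ζ‖) := by nlinarith
    have h5 : (1 + (L : ℝ)) * (13 * σ) ≤ (1 + L) * (2 * ‖ζ‖) := by nlinarith
    have h6 := le_of_mul_le_mul_left h5 (by positivity)
    linarith
  · have e : y - g = (y - z) + ((z - Q.center) + (Q.center - g)) := by abel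
    have h1 := norm_add_le (y - z) ((z - Q.center) + (Q.center - g))
    have h2 := norm_add_le (z - Q.center) (Q.center - g)
    rw [← e] at h1
    calc ‖y - g‖ ≤ σ + (81 * Real.sqrt n * (2 * L + 1) * Q.side + σ) := by linarith
      _ = _ := by rw [hσ]; ring

end


/-! ### Distance layers and the integral of the Dini function over a graph -/

section

variable {n : ℕ}

/-- Layers of comparable thickness and height have bounded overlap. -/
theorem exists_tsum_measure_layer_le {X : Type*} [MeasurableSpace X] (μ : Measure X) {d : X → ℝ}
    (hd : Measurable d) {B : Set X} (hB : MeasurableSet B) (C : ℝ) :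
    ∃ N : ℕ, ∑' k : ℤ, μ {y | y ∈ B ∧ (2 : ℝ) ^ (-k) ≤ d y ∧ d y ≤ C * 2 ^ (-k)} ≤ N * μ B := by
  obtain ⟨N, hN⟩ := pow_unbounded_of_one_lt C (by norm_num : (1 : ℝ) < 2)
  -- As `C < 2 ^ N`, layer `k` lies in the shells `-k + j` with `0 ≤ j < N`; for fixed `j` these are
  -- disjoint as `k` varies.
  let shell : ℤ → Set X := fun l => B ∩ d ⁻¹' Set.Ico ((2 : ℝ) ^ l) (2 ^ (l + 1))
  have hshell : ∀ l, MeasurableSet (shell l) := fun l => hB.inter (hd measurableSet_Ico)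
  have hlt : ∀ {l l' : ℤ} {y : X}, y ∈ shell l → y ∈ shell l' → l ≤ l' := by
    intro l l' y h h'
    have h1 : (2 : ℝ) ^ l < 2 ^ (l' + 1) := h.2.1.trans_lt h'.2.2
    have := (zpow_lt_zpow_iff_right₀ (by norm_num : (1 : ℝ) < 2)).1 h1
    omega
  have hdisj : Pairwise (Function.onFun Disjoint shell) := by
    intro l l' hne
    refine Set.disjoint_left.2 fun y h h' => hne (le_antisymm (hlt h h') (hlt h' h))
  have hsum : ∀ j : ℕ, ∑' k : ℤ, μ (shell (-k + j)) ≤ μ B := by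
    intro j
    have hinj : Function.Injective fun k : ℤ => -k + (j : ℤ) := fun a b h => by
      simp only at h
      omega
    rw [← measure_iUnion (fun a b hab => @hdisj (-a + j) (-b + j) (hinj.ne hab)) fun k => hshell _]
    exact measure_mono (Set.iUnion_subset fun k => Set.inter_subset_left)
  refine ⟨N, ?_⟩
  calc ∑' k : ℤ, μ {y | y ∈ B ∧ (2 : ℝ) ^ (-k) ≤ d y ∧ d y ≤ C * 2 ^ (-k)}
      ≤ ∑' k : ℤ, ∑ j ∈ Finset.range N, μ (shell (-k + j)) := by
        refine ENNReal.tsum_le_tsum fun k => ?_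
        refine (measure_mono ?_).trans (measure_biUnion_finset_le _ _)
        rintro y ⟨hyB, h1, h2⟩
        have hdy : 0 < d y := lt_of_lt_of_le (by positivity) h1
        have h3 : (2 : ℝ) ^ Int.log 2 (d y) ≤ d y := by
          exact_mod_cast Int.zpow_log_le_self (b := 2) (by norm_num) hdy
        have h4 : d y < (2 : ℝ) ^ (Int.log 2 (d y) + 1) := by
          exact_mod_cast Int.lt_zpow_succ_log_self (b := 2) (by norm_num) (d y)
        have h5 : -k < Int.log 2 (d y) + 1 :=
          (zpow_lt_zpow_iff_right₀ (by norm_num : (1 : ℝ) < 2)).1 (h1.trans_lt h4)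
        have h6 : Int.log 2 (d y) < N + -k := by
          refine (zpow_lt_zpow_iff_right₀ (by norm_num : (1 : ℝ) < 2)).1 (h3.trans_lt ?_)
          rw [zpow_add₀ (by norm_num), zpow_natCast]
          exact h2.trans_lt (by gcongr)
        simp only [Set.mem_iUnion, Finset.mem_range, exists_prop]
        refine ⟨(Int.log 2 (d y) + k).toNat, by omega, hyB, ?_⟩
        have h7 : -k + ((Int.log 2 (d y) + k).toNat : ℤ) = Int.log 2 (d y) := by omega
        rw [h7]
        exact ⟨h3, h4⟩
    _ = ∑ j ∈ Finset.range N, ∑' k : ℤ, μ (shell (-k + j)) :=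
        Summable.tsum_finsetSum fun _ _ => ENNReal.summable
    _ ≤ ∑ _j ∈ Finset.range N, μ B := Finset.sum_le_sum fun j _ => hsum j
    _ = N * μ B := by simp

/-- Dyadic cubes are pairs of a generation and a corner. -/
def DyadicCube.equivProd : ℤ × (Fin n → ℤ) ≃ DyadicCube n where
  toFun p := ⟨p.1, p.2⟩
  invFun Q := (Q.gen, Q.corner)
  left_inv _ := rfl
  right_inv _ := rfl

/-- The cubes of one generation partition the space into measurable pieces, so `A k` itself may be
arbitrary. -/
theorem tsum_measure_inter_gen (μ : Measure (Euc n)) {A : ℤ → Set (Euc n)} :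
    ∑' Q : DyadicCube n, μ (Q.toSet ∩ A Q.gen) = ∑' k : ℤ, μ (A k) := by
  rw [← DyadicCube.equivProd.tsum_eq, ENNReal.tsum_prod']
  refine tsum_congr fun k => ?_
  have hcover : ⋃ c : Fin n → ℤ, (DyadicCube.equivProd (k, c)).toSet = Set.univ :=
    Set.eq_univ_of_forall fun x => Set.mem_iUnion.2 ⟨_, DyadicCube.mem_cubeAt k x⟩
  have hdisj : Pairwise (Function.onFun Disjoint
      fun c : Fin n → ℤ => (DyadicCube.equivProd (k, c)).toSet) := by
    intro c c' hne
    refine Set.disjoint_left.2 fun x h h' => hne ?_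
    exact congrArg DyadicCube.corner (DyadicCube.eq_of_gen_eq
      (P := DyadicCube.equivProd (k, c)) (Q := DyadicCube.equivProd (k, c')) rfl h h')
  have h := measure_iUnion (μ := μ.restrict (A k)) hdisj
    fun c => DyadicCube.measurableSet_toSet _
  rw [hcover, Measure.restrict_apply_univ] at h
  rw [h]
  exact tsum_congr fun c => (Measure.restrict_apply (DyadicCube.measurableSet_toSet _)).symm

theorem abs_corner_sub_le {Q R : DyadicCube n} {x y : Euc n} {C : ℝ} (h : R.gen = Q.gen)
    (hx : x ∈ Q.toSet) (hy : y ∈ R.toSet) (hxy : ‖y - x‖ ≤ C * Q.side) (i : Fin n) :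
    |R.corner i - Q.corner i| ≤ ⌈C⌉ + 1 := by
  have h2 : (0 : ℝ) < 2 ^ Q.gen := by positivity
  have hxi := DyadicCube.mem_toSet_iff.1 hx i
  have hyi := DyadicCube.mem_toSet_iff.1 hy i
  rw [h] at hyi
  rw [Int.floor_eq_iff] at hxi hyi
  have h3 : |y i * 2 ^ Q.gen - x i * 2 ^ Q.gen| ≤ C := by
    rw [← sub_mul, abs_mul, abs_of_pos h2]
    calc |y i - x i| * 2 ^ Q.gen ≤ (C * Q.side) * 2 ^ Q.gen := by
          gcongr
          exact (abs_apply_le_norm (y - x) i).trans hxy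
      _ = C := by rw [DyadicCube.side, mul_assoc, ← zpow_add₀ (by norm_num)]; simp
  have hC := Int.le_ceil C
  rw [abs_le] at h3 ⊢
  constructor
  · have : (-(⌈C⌉ + 1 : ℤ) : ℝ) ≤ R.corner i - Q.corner i := by push_cast; linarith
    exact_mod_cast this
  · have : (R.corner i - Q.corner i : ℝ) ≤ (⌈C⌉ + 1 : ℤ) := by push_cast; linarith
    exact_mod_cast this

/-- Enlarging `Q ∩ Γ ∩ Q₀` to `Q` cancels the denominator of the defect. Each related cube is a
shift of `Q` by one of finitely many offsets and lies in the layer `A Q.gen`; for a fixed offset the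
shift is injective, so the sum over `Q` is at most the sum of the masses of the layers. -/
theorem lintegral_relDini_graph_lt_top (hn : 0 < n) (μ : Measure (Euc n))
    [IsFiniteMeasureOnCompacts μ] {V : Submodule ℝ (Euc n)} {f : V → Vᗮ} {L : ℝ≥0}
    (hf : LipschitzWith L f) (Q₀ : DyadicCube n) :
    ∫⁻ x in graph V f ∩ Q₀.toSet,
      relDini μ (fun Q => discreteAnnulus Q V (2 * L + 1)) x ∂μ < ⊤ := by
  set Γ := graph V f
  set D : DyadicCube n → Set (DyadicCube n) := fun Q => discreteAnnulus Q V (2 * L + 1)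
  set C : ℝ := Real.sqrt n * (81 * (2 * L + 1) + 2)
  have hC : 0 ≤ C := by positivity
  -- Sides at most `1` keep all related cubes in this ball, which has finite measure.
  set B := Metric.closedBall Q₀.center (Real.sqrt n * Q₀.side + C)
  set A : ℤ → Set (Euc n) := fun k =>
    {y | y ∈ B ∧ (2 : ℝ) ^ (-k) ≤ Metric.infDist y Γ ∧ Metric.infDist y Γ ≤ C * 2 ^ (-k)}
  obtain ⟨N, hN⟩ := exists_tsum_measure_layer_le μ (d := fun y => Metric.infDist y Γ)
    (Metric.continuous_infDist_pt Γ).measurable (B := B) Metric.isClosed_closedBall.measurableSet C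
  let T : Finset (Fin n → ℤ) := Fintype.piFinset fun _ => Finset.Icc (-(⌈C⌉ + 1)) (⌈C⌉ + 1)
  let shift : (Fin n → ℤ) → DyadicCube n → DyadicCube n := fun t Q => ⟨Q.gen, Q.corner + t⟩
  have hshift : ∀ t, Function.Injective (shift t) := by
    rintro t ⟨k, c⟩ ⟨k', c'⟩ h
    simpa [shift] using h
  have hQ : ∀ Q : {Q : DyadicCube n // Q.side ≤ 1},
      relDefect μ D Q * μ (Q.1.toSet ∩ (Γ ∩ Q₀.toSet)) ≤
        ∑ t ∈ T, μ ((shift t Q.1).toSet ∩ A Q.1.gen) := by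
    intro Q
    rcases Set.eq_empty_or_nonempty (Q.1.toSet ∩ (Γ ∩ Q₀.toSet)) with he | ⟨g, hgQ, hgΓ, hg₀⟩
    · simp [he]
    have hR : ∀ R ∈ D Q.1, R.1 = Q.1.gen ∧ R.corner - Q.1.corner ∈ T ∧ R.toSet ⊆ A Q.1.gen := by
      intro R hR
      have hgen : R.gen = Q.1.gen := DyadicCube.side_eq_iff.1 hR.1
      have hb := fun y hy => discreteAnnulus_graph_bounds hn hf hgΓ hgQ hR (y := y) hy
      refine ⟨hgen, ?_, fun y hy => ⟨?_, (hb y hy).1, ?_⟩⟩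
      · rw [Fintype.mem_piFinset]
        intro i
        rw [Finset.mem_Icc, ← abs_le]
        exact abs_corner_sub_le hgen hgQ R.center_mem (hb _ R.center_mem).2 i
      · rw [Metric.mem_closedBall, dist_eq_norm]
        have h1 := norm_sub_le_norm_sub_add_norm_sub y g Q₀.center
        have h2 := DyadicCube.norm_sub_le hg₀ Q₀.center_mem
        have h3 : ‖y - g‖ ≤ C := (hb y hy).2.trans (mul_le_of_le_one_right hC Q.2)
        linarith
      · refine (Metric.infDist_le_dist_of_mem hgΓ).trans ?_
        rw [dist_eq_norm]
        exact (hb y hy).2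
    calc relDefect μ D Q * μ (Q.1.toSet ∩ (Γ ∩ Q₀.toSet)) ≤ relDefect μ D Q * μ Q.1.toSet := by
          gcongr
          exact Set.inter_subset_left
      _ ≤ ∑' R : D Q.1, μ R.1.toSet := relDefect_mul_measure_le μ D Q.1
      _ = ∑' R : D Q.1, μ ((shift (R.1.corner - Q.1.corner) Q.1).toSet ∩ A Q.1.gen) := by
          refine tsum_congr fun R => ?_
          have h1 : shift (R.1.corner - Q.1.corner) Q.1 = R.1 := by
            obtain ⟨⟨k, c⟩, hRD⟩ := R
            obtain rfl : k = Q.1.gen := (hR _ hRD).1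
            simp [shift]
          rw [h1, Set.inter_eq_left.2 (hR R.1 R.2).2.2]
      _ ≤ ∑' t : T, μ ((shift t Q.1).toSet ∩ A Q.1.gen) := by
          let φ : D Q.1 → T := fun R => ⟨R.1.corner - Q.1.corner, (hR R.1 R.2).2.1⟩
          have hφ : Function.Injective φ := by
            rintro ⟨⟨k, c⟩, h⟩ ⟨⟨k', c'⟩, h'⟩ he
            obtain rfl : k = Q.1.gen := (hR _ h).1
            obtain rfl : k' = Q.1.gen := (hR _ h').1
            simpa [φ] using he
          exact ENNReal.tsum_comp_le_tsum_of_injective hφ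
            fun t : T => μ ((shift t Q.1).toSet ∩ A Q.1.gen)
      _ = ∑ t ∈ T, μ ((shift t Q.1).toSet ∩ A Q.1.gen) :=
          Finset.tsum_subtype T fun t => μ ((shift t Q.1).toSet ∩ A Q.1.gen)
  rw [lintegral_relDini]
  calc ∑' Q : {Q : DyadicCube n // Q.side ≤ 1}, relDefect μ D Q * μ (Q.1.toSet ∩ (Γ ∩ Q₀.toSet))
      ≤ ∑' Q : {Q : DyadicCube n // Q.side ≤ 1},
          ∑ t ∈ T, μ ((shift t Q.1).toSet ∩ A Q.1.gen) := ENNReal.tsum_le_tsum hQ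
    _ = ∑ t ∈ T, ∑' Q : {Q : DyadicCube n // Q.side ≤ 1},
          μ ((shift t Q.1).toSet ∩ A Q.1.gen) := Summable.tsum_finsetSum fun _ _ => ENNReal.summable
    _ ≤ ∑ _t ∈ T, (N : ℝ≥0∞) * μ B := by
        refine Finset.sum_le_sum fun t _ => ?_
        refine (ENNReal.tsum_comp_le_tsum_of_injective
          ((hshift t).comp (Subtype.val_injective (p := fun Q : DyadicCube n => Q.side ≤ 1)))
          fun P : DyadicCube n => μ (P.toSet ∩ A P.gen)).trans ?_
        rw [tsum_measure_inter_gen]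
        exact hN
    _ < ⊤ := by
        rw [Finset.sum_const, nsmul_eq_mul]
        exact ENNReal.mul_lt_top (ENNReal.natCast_lt_top _)
          (ENNReal.mul_lt_top (ENNReal.natCast_lt_top _) Metric.isBounded_closedBall.measure_lt_top)

/-- A finite integral makes the Dini function finite almost everywhere for the restricted measure.
Taking for `E` the whole finiteness set avoids any measurability question about the graph. -/
theorem exists_conicalDini_lt_top_of_graph (hn : 0 < n) (μ : Measure (Euc n))
    [IsFiniteMeasureOnCompacts μ] {V : Submodule ℝ (Euc n)} {f : V → Vᗮ} {L : ℝ≥0}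
    (hf : LipschitzWith L f) (hμ : 0 < μ (graph V f)) :
    ∃ E : Set (Euc n), 0 < μ E ∧ ∀ x ∈ E, conicalDini μ V (2 * L + 1) x < ⊤ := by
  have hcover : graph V f ⊆ ⋃ Q : {Q : DyadicCube n // Q.gen = 0}, graph V f ∩ Q.1.toSet := by
    rw [← Set.inter_iUnion, DyadicCube.iUnion_toSet_gen, Set.inter_univ]
  obtain ⟨Q₀, hQ₀⟩ := exists_measure_pos_of_not_measure_iUnion_null
    (hμ.trans_le (measure_mono hcover)).ne'
  set D : DyadicCube n → Set (DyadicCube n) := fun Q => discreteAnnulus Q V (2 * L + 1) with hD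
  have hm := measurable_relDini μ D
  have hae := ae_lt_top hm (lintegral_relDini_graph_lt_top hn μ hf Q₀.1).ne
  refine ⟨{x | relDini μ D x < ⊤}, ?_, fun x hx => hx⟩
  have h1 : μ.restrict (graph V f ∩ Q₀.1.toSet) {x | relDini μ D x < ⊤} =
      μ (graph V f ∩ Q₀.1.toSet) := by
    rw [measure_congr (Filter.eventuallyEq_univ.2 hae), Measure.restrict_apply_univ]
  calc 0 < μ (graph V f ∩ Q₀.1.toSet) := hQ₀
    _ = μ.restrict (graph V f ∩ Q₀.1.toSet) {x | relDini μ D x < ⊤} := h1.symm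
    _ ≤ μ {x | relDini μ D x < ⊤} := Measure.restrict_apply_le _ _

end

end RadonGraphs

end

theorem corollary1p7 (n m : ℕ) (hm : 1 ≤ m) (hmn : m < n)
    (μ : MeasureTheory.Measure (RadonGraphs.Euc n))
    [MeasureTheory.IsFiniteMeasureOnCompacts μ] :
    (∃ Γ : Set (RadonGraphs.Euc n), RadonGraphs.IsLipschitzGraph m Γ ∧ 0 < μ Γ) ↔
      ∃ E : Set (RadonGraphs.Euc n), 0 < μ E ∧
        ∀ x ∈ E, ∃ V : Submodule ℝ (RadonGraphs.Euc n), Module.finrank ℝ V = m ∧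
          ∃ α : ℝ, 0 < α ∧ RadonGraphs.conicalDini μ V α x < ⊤ := by
  have hn : 0 < n := hm.trans hmn.le
  constructor
  · rintro ⟨_, ⟨V, hV, f, ⟨L, hf⟩, rfl⟩, hμ⟩
    obtain ⟨E, hE, h⟩ := RadonGraphs.exists_conicalDini_lt_top_of_graph hn μ hf hμ
    exact ⟨E, hE, fun x hx => ⟨V, hV, 2 * L + 1, by positivity, h x hx⟩⟩
  · rintro ⟨E, hE, h⟩
    exact RadonGraphs.exists_lipschitz_graph_of_conicalDini μ hn hE h
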